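/- Let $(\Omega,\mathcal F)$ be a measurable space with a filtration $(\mathcal F_t)_{t\ge 0}$, and let $\mu,\nu,\mathrm P$ be probability measures on it. For a measure $\rho$, write $\rho_t$ for its restriction to $\mathcal F_t$, and assume that $\mu_t\ll \mathrm P_t$ and $\nu_t\ll \mathrm P_t$ for every $t\ge 0$. Let $z$ and $z'$ be the density processes of $\mu$ and $\nu$ relative to $\mathrm P$, that is, adapted processes such that $z_t=d\mu_t/d\mathrm P_t$ and $z'_t=d\nu_t/d\mathrm P_t$, $\mathrm P$-a.s., for every $t\ge 0$. For a stopping time $T:\Omega\to[0,\infty]$, let $\mathcal F_{T-}$ be the $\sigma$-algebra generated by $\mathcal F_0$ and the sets $A\cap\{t<T\}$ with $t\ge 0$, $A\in\mathcal F_t$, and let $\mu_{T-},\nu_{T-}$ be the restrictions of $\mu,\nu$ to $\mathcal F_{T-}$. Let $(\mu_{T-})_a$ be the absolutely continuous part of $\mu_{T-}$ relative to $\nu_{T-}$ in the Lebesgue decomposition, and $\|(\mu_{T-})_a\|=(\mu_{T-})_a(\Omega)$ its norm. Then for every stopping time $T$ $$ \|(\mu_{T-})_a\|=\liminf_{\substack{n\to\infty\\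 \alpha\to 1-0}}\Bigg\{\int z_0^{\alpha}{z'_0}^{1-\alpha}1_{\{T=0\}}\,d\mathrm P+\int z_n^{\alpha}{z'_n}^{1-\alpha}1_{\{n<T\}}\,d\mathrm P $$ $$ +\sum_{k=1}^{n2^n}\int\Big(\mathbf E\big[z_{k/2^n}1_{\{\frac{k-1}{2^n}<T\le\frac{k}{2^n}\}}\,\big|\,\mathcal F_{\frac{k-1}{2^n}}\big]\Big)^{\alpha}\Big(\mathbf E\big[z'_{k/2^n}1_{\{\frac{k-1}{2^n}<T\le\frac{k}{2^n}\}}\,\big|\,\mathcal F_{\frac{k-1}{2^n}}\big]\Big)^{1-\alpha}d\mathrm P\Bigg\}, $$ where $\mathbf E$ is the expectation under $\mathrm P$ and the lower limit is taken jointly in $n\in\mathbb N$, $n\to\infty$, and $\alpha\in(0,1)$, $\alpha\to 1$. -/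

import Mathlib

open MeasureTheory Filter Topology
open scoped NNReal ENNReal

namespace HellingerLeft

variable {Ω : Type*} {m : MeasurableSpace Ω}

/-- The σ-algebra `𝓕_{T-}`: it is generated by `𝓕_0` and by the sets `A ∩ {t < T}` with
`A ∈ 𝓕_t` and `t ≥ 0`. -/
@[reducible] def leftSigma (F : Filtration ℝ≥0 m) (T : Ω → WithTop ℝ≥0) : MeasurableSpace Ω :=
  MeasurableSpace.generateFrom
    ({A | MeasurableSet[F 0] A} ∪
      {B | ∃ t : ℝ≥0, ∃ A : Set Ω, MeasurableSet[F t] A ∧ B = A ∩ {ω | (t : WithTop ℝ≥0) < T ω}})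

theorem leftSigma_le {F : Filtration ℝ≥0 m} {T : Ω → WithTop ℝ≥0} (hT : IsStoppingTime F T) :
    leftSigma F T ≤ m := by
  refine MeasurableSpace.generateFrom_le ?_
  rintro B (hB | ⟨t, A, hA, rfl⟩)
  · exact F.le 0 _ hB
  · have h : {ω | (t : WithTop ℝ≥0) < T ω} = {ω | T ω ≤ t}ᶜ := by
      ext ω; exact (not_le (a := T ω) (b := (t : WithTop ℝ≥0))).symm
    rw [h]
    exact (F.le t _ hA).inter (F.le t _ (hT t)).compl

/-- The restriction `μ_{T-}` of `μ` to `𝓕_{T-}`. -/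
noncomputable def leftMeasure (μ : Measure Ω) {F : Filtration ℝ≥0 m} {T : Ω → WithTop ℝ≥0}
    (hT : IsStoppingTime F T) : @Measure Ω (leftSigma F T) :=
  μ.trim (leftSigma_le hT)

/-- The absolutely continuous part of `μ` relative to `ν` in the Lebesgue decomposition
`μ = μ.singularPart ν + acPart μ ν`. -/
noncomputable def acPart (μ ν : Measure Ω) : Measure Ω :=
  ν.withDensity (μ.rnDeriv ν)

/-- `μ` is locally absolutely continuous relative to `P`: `μ_t ≪ P_t` for all `t`, where `μ_t` and
`P_t` are the restrictions to `𝓕_t`. -/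
def LocallyAC (F : Filtration ℝ≥0 m) (μ P : Measure Ω) : Prop :=
  ∀ t : ℝ≥0, μ.trim (F.le t) ≪ P.trim (F.le t)

/-- `z` is a density process of `μ` relative to `P`: an adapted process such that `z t` is a version
of the Radon-Nikodym derivative `dμ_t / dP_t` for each `t`. Regularity of the paths is not
required. -/
structure IsDensityProcess (F : Filtration ℝ≥0 m) (μ P : Measure Ω) (z : ℝ≥0 → Ω → ℝ) : Prop where
  adapted : StronglyAdapted F z
  ae_eq : ∀ t : ℝ≥0,
    z t =ᵐ[P.trim (F.le t)] fun ω => ((μ.trim (F.le t)).rnDeriv (P.trim (F.le t)) ω).toReal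

/-- The dyadic time `k / 2 ^ n`. -/
noncomputable def dyadicTime (n k : ℕ) : ℝ≥0 := (k : ℝ≥0) / 2 ^ n

/-- For `k ≥ 1`, the event `{(k - 1) / 2 ^ n < T ≤ k / 2 ^ n}`. -/
def dyadicEvent (T : Ω → WithTop ℝ≥0) (n k : ℕ) : Set Ω :=
  {ω | (dyadicTime n (k - 1) : WithTop ℝ≥0) < T ω ∧ T ω ≤ (dyadicTime n k : WithTop ℝ≥0)}

/-- The conditional expectation, for `k ≥ 1`,
`E_P[z_{k / 2 ^ n} 1_{(k - 1) / 2 ^ n < T ≤ k / 2 ^ n} | 𝓕_{(k - 1) / 2 ^ n}]`. -/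
noncomputable def dyadicCondExp (F : Filtration ℝ≥0 m) (P : Measure Ω) (T : Ω → WithTop ℝ≥0)
    (z : ℝ≥0 → Ω → ℝ) (n k : ℕ) : Ω → ℝ :=
  P[(dyadicEvent T n k).indicator (z (dyadicTime n k)) | F (dyadicTime n (k - 1))]

/-- The sum of Hellinger-type integrals under the lower limit. The integrands are nonnegative
`P`-almost everywhere, and the integrals are Lebesgue integrals with values in `[0, ∞]`. -/
noncomputable def hellingerSum (F : Filtration ℝ≥0 m) (P : Measure Ω) (T : Ω → WithTop ℝ≥0)
    (z z' : ℝ≥0 → Ω → ℝ) (n : ℕ) (α : ℝ) : ℝ≥0∞ :=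
  (∫⁻ ω in {ω | T ω = 0}, ENNReal.ofReal (z 0 ω ^ α * z' 0 ω ^ (1 - α)) ∂P)
  + (∫⁻ ω in {ω | ((n : ℝ≥0) : WithTop ℝ≥0) < T ω},
      ENNReal.ofReal (z n ω ^ α * z' n ω ^ (1 - α)) ∂P)
  + ∑ k ∈ Finset.Icc 1 (n * 2 ^ n),
      ∫⁻ ω, ENNReal.ofReal
        (dyadicCondExp F P T z n k ω ^ α * dyadicCondExp F P T z' n k ω ^ (1 - α)) ∂P

end HellingerLeft

namespace HellingerLeft

/-! Write H_α(μ, ν) = ∫ (dμ/dλ)^α (dν/dλ)^(1-α) dλ, which does not depend on the dominating λ. Cut Ω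
at level n into {T = 0}, the strips {(k-1)/2^n < T ≤ k/2^n} and {n < T}, and let 𝒢_n consist of the
sets whose trace on each cell is that of a set known at the left endpoint of the cell. The functions
under the lower limit are the densities relative to P of the measures restricted to the cells, so
the bracket is exactly H_α on 𝒢_n (`hellingerSum_eq_hellingerIntegral`), and the 𝒢_n increase to
𝓕_{T-} (`cellSigma_le_succ`, `iSup_cellFiltration`).

Three facts finish the proof. H_α can only grow when the σ-algebra shrinks
(`hellingerIntegral_le_trim`). For fixed α, H_α on 𝒢_n tends to H_α on 𝓕_{T-}
(`tendsto_hellingerIntegral_trim`). As α → 1-0, H_α tends to the mass of the absolutely continuous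
part (`tendsto_hellingerIntegral_one`). The first and third bound the bracket from below uniformly
in n. The second and third, with α chosen before n, give brackets arbitrarily close to that mass. A
lower limit is needed: if α → 1 fast compared with n, the bracket follows the absolutely continuous
mass on 𝒢_n, which can stay larger. -/

/-- The Hellinger integral of order `α` of two measures, `∫ (dμ/dλ)^α (dν/dλ)^(1-α) dλ` with the
dominating measure `λ = μ + ν`. -/
noncomputable def hellingerIntegral {X : Type*} {mX : MeasurableSpace X} (α : ℝ)
    (μ ν : Measure X) : ℝ≥0∞ :=
  ∫⁻ x, μ.rnDeriv (μ + ν) x ^ α * ν.rnDeriv (μ + ν) x ^ (1 - α) ∂(μ + ν)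

/-! ### Hellinger integrals: monotonicity, martingale convergence, the limit α → 1 -/

section Generic

variable {X : Type*} {mX : MeasurableSpace X} {μ ν ρ : Measure X} {α : ℝ}

theorem withDensity_rnDeriv_add_left (μ ν : Measure X) [IsFiniteMeasure μ] [IsFiniteMeasure ν] :
    (μ + ν).withDensity (μ.rnDeriv (μ + ν)) = μ :=
  Measure.withDensity_rnDeriv_eq _ _ (Measure.AbsolutelyContinuous.rfl.add_right _)

theorem withDensity_rnDeriv_add_right (μ ν : Measure X) [IsFiniteMeasure μ] [IsFiniteMeasure ν] :
    (μ + ν).withDensity (ν.rnDeriv (μ + ν)) = ν :=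
  Measure.withDensity_rnDeriv_eq _ _ (Measure.AbsolutelyContinuous.rfl.add_right' _)

/-- The Hellinger integral does not depend on the dominating measure. -/
theorem hellingerIntegral_eq_lintegral [IsFiniteMeasure μ] [IsFiniteMeasure ν]
    {f g : X → ℝ≥0∞} (hf : Measurable f) (hg : Measurable g)
    (hμ : ρ.withDensity f = μ) (hν : ρ.withDensity g = ν) (h0 : 0 < α) (h1 : α < 1) :
    hellingerIntegral α μ ν = ∫⁻ x, f x ^ α * g x ^ (1 - α) ∂ρ := by
  set φ := μ.rnDeriv (μ + ν) with hφ
  set ψ := ν.rnDeriv (μ + ν) with hψ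
  have hmφ : Measurable φ := Measure.measurable_rnDeriv _ _
  have hmψ : Measurable ψ := Measure.measurable_rnDeriv _ _
  have hsum : μ + ν = ρ.withDensity (f + g) := by
    rw [withDensity_add_left hf, hμ, hν]
  have hfi : ∫⁻ x, f x ∂ρ ≠ ∞ := by
    have : μ Set.univ ≠ ∞ := measure_ne_top _ _
    rwa [← hμ, withDensity_apply _ .univ, Measure.restrict_univ] at this
  have hgi : ∫⁻ x, g x ∂ρ ≠ ∞ := by
    have : ν Set.univ ≠ ∞ := measure_ne_top _ _
    rwa [← hν, withDensity_apply _ .univ, Measure.restrict_univ] at this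
  -- Chain rule through μ + ν, whose density is f + g. Since α + (1 - α) = 1, the integrand is
  -- homogeneous of degree one and the factor f + g comes out of the powers.
  have hfe : f =ᵐ[ρ] (f + g) * φ := by
    refine (withDensity_eq_iff hf.aemeasurable ((hf.add hg).mul hmφ).aemeasurable hfi).1 ?_
    rw [withDensity_mul _ (hf.add hg) hmφ, ← hsum, withDensity_rnDeriv_add_left, hμ]
  have hge : g =ᵐ[ρ] (f + g) * ψ := by
    refine (withDensity_eq_iff hg.aemeasurable ((hf.add hg).mul hmψ).aemeasurable hgi).1 ?_
    rw [withDensity_mul _ (hf.add hg) hmψ, ← hsum, withDensity_rnDeriv_add_right, hν]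
  have h1' : 0 < 1 - α := by linarith
  rw [hellingerIntegral, ← hφ, ← hψ, hsum, lintegral_withDensity_eq_lintegral_mul _ (hf.add hg)
    (by fun_prop)]
  refine lintegral_congr_ae ?_
  filter_upwards [hfe, hge] with x hx hy
  simp only [Pi.mul_apply, Pi.add_apply] at hx hy ⊢
  have ex : f x ^ α = (f x + g x) ^ α * φ x ^ α := by
    rw [← ENNReal.mul_rpow_of_nonneg _ _ h0.le, ← hx]
  have ey : g x ^ (1 - α) = (f x + g x) ^ (1 - α) * ψ x ^ (1 - α) := by
    rw [← ENNReal.mul_rpow_of_nonneg _ _ h1'.le, ← hy]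
  rw [ex, ey]
  have : (f x + g x) ^ α * (f x + g x) ^ (1 - α) = f x + g x := by
    rw [← ENNReal.rpow_add_of_nonneg _ _ h0.le h1'.le]; simp
  nth_rw 1 [← this]
  ring

/-- The concave function (a, b) ↦ a^α b^(1-α) lies below its tangent plane at (c, d), by weighted
AM-GM for a/c and b/d. With (c, d) the densities on a smaller σ-algebra, this bound, linear in (a,
b), replaces a conditional Jensen inequality. -/
theorem ENNReal_young {a b c d : ℝ≥0∞} (h0 : 0 < α) (h1 : α < 1) (hc : c ≠ 0) (hc' : c ≠ ∞)
    (hd : d ≠ 0) (hd' : d ≠ ∞) (ha : a ≠ ∞) (hb : b ≠ ∞) :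
    a ^ α * b ^ (1 - α) ≤ c ^ α * d ^ (1 - α) *
      (ENNReal.ofReal α * (a / c) + ENNReal.ofReal (1 - α) * (b / d)) := by
  lift a to ℝ≥0 using ha
  lift b to ℝ≥0 using hb
  lift c to ℝ≥0 using hc'
  lift d to ℝ≥0 using hd'
  have hc : c ≠ 0 := by simpa using hc
  have hd : d ≠ 0 := by simpa using hd
  have h1' : 0 < 1 - α := by linarith
  rw [← ENNReal.coe_div hc, ← ENNReal.coe_div hd]
  simp only [ENNReal.ofReal, ← ENNReal.coe_rpow_of_nonneg _ h0.le,
    ← ENNReal.coe_rpow_of_nonneg _ h1'.le]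
  norm_cast
  have := NNReal.geom_mean_le_arith_mean2_weighted α.toNNReal (1 - α).toNNReal (a / c) (b / d)
    (by rw [← Real.toNNReal_add h0.le h1'.le]; simp)
  rw [Real.coe_toNNReal _ h0.le, Real.coe_toNNReal _ h1'.le] at this
  have e : a ^ α * b ^ (1 - α) = c ^ α * d ^ (1 - α) * ((a / c) ^ α * (b / d) ^ (1 - α)) := by
    rw [NNReal.div_rpow, NNReal.div_rpow]
    have := (NNReal.rpow_pos (p := α) (pos_iff_ne_zero.2 hc)).ne'
    have := (NNReal.rpow_pos (p := 1 - α) (pos_iff_ne_zero.2 hd)).ne'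
    field_simp
  rw [e]
  gcongr

theorem withDensity_rnDeriv_trim {G : MeasurableSpace X} (hG : G ≤ mX) [IsFiniteMeasure μ]
    [IsFiniteMeasure ρ] (h : μ ≪ ρ) :
    (ρ.trim hG).withDensity ((μ.trim hG).rnDeriv (ρ.trim hG)) = μ.trim hG :=
  Measure.withDensity_rnDeriv_eq _ _ (h.trim hG)

/-- The Hellinger integral does not decrease under restriction to a smaller σ-algebra. -/
theorem hellingerIntegral_le_trim {G : MeasurableSpace X} (hG : G ≤ mX) [IsFiniteMeasure μ]
    [IsFiniteMeasure ν] (h0 : 0 < α) (h1 : α < 1) :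
    hellingerIntegral α μ ν ≤ hellingerIntegral α (μ.trim hG) (ν.trim hG) := by
  have h1' : 0 < 1 - α := by linarith
  set ρ := μ + ν with hρ
  have hμρ : μ ≪ ρ := Measure.AbsolutelyContinuous.rfl.add_right _
  have hνρ : ν ≪ ρ := Measure.AbsolutelyContinuous.rfl.add_right' _
  set f := μ.rnDeriv ρ with hf
  set g := ν.rnDeriv ρ with hg
  set f' := (μ.trim hG).rnDeriv (ρ.trim hG) with hf'
  set g' := (ν.trim hG).rnDeriv (ρ.trim hG) with hg'
  have mf : Measurable[mX] f := Measure.measurable_rnDeriv _ _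
  have mg : Measurable[mX] g := Measure.measurable_rnDeriv _ _
  have mf' : Measurable[G] f' := Measure.measurable_rnDeriv _ _
  have mg' : Measurable[G] g' := Measure.measurable_rnDeriv _ _
  -- The density on `G` is the conditional expectation of the full density: both have the same
  -- integrals against `G`-measurable functions.
  have key : ∀ (σ : @Measure X mX) [IsFiniteMeasure σ], σ ≪ ρ → ∀ φ : X → ℝ≥0∞, Measurable[G] φ →
      ∫⁻ x, σ.rnDeriv ρ x * φ x ∂ρ
        = ∫⁻ x, (σ.trim hG).rnDeriv (ρ.trim hG) x * φ x ∂(ρ.trim hG) := by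
    intro σ _ hσ φ hφ
    rw [lintegral_rnDeriv_mul hσ (hφ.mono hG le_rfl).aemeasurable,
      lintegral_rnDeriv_mul (hσ.trim hG) hφ.aemeasurable, lintegral_trim hG hφ]
  -- Test `key` against the indicator of the zero set of the coarse density.
  have hzero : ∀ (σ : @Measure X mX) [IsFiniteMeasure σ], σ ≪ ρ →
      ∀ᵐ x ∂ρ, (σ.trim hG).rnDeriv (ρ.trim hG) x = 0 → σ.rnDeriv ρ x = 0 := by
    intro σ _ hσ
    have m' : Measurable[G] ((σ.trim hG).rnDeriv (ρ.trim hG)) := Measure.measurable_rnDeriv _ _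
    have mS : MeasurableSet[G] {x | (σ.trim hG).rnDeriv (ρ.trim hG) x = 0} :=
      m' (measurableSet_singleton 0)
    have := key σ hσ ({x | (σ.trim hG).rnDeriv (ρ.trim hG) x = 0}.indicator 1)
      (measurable_one.indicator mS)
    have e : ∀ x, (σ.trim hG).rnDeriv (ρ.trim hG) x *
        {x | (σ.trim hG).rnDeriv (ρ.trim hG) x = 0}.indicator 1 x = 0 := by
      intro x; by_cases h : (σ.trim hG).rnDeriv (ρ.trim hG) x = 0 <;> simp [h]
    simp only [e, lintegral_zero] at this
    have ms : Measurable[mX] (σ.rnDeriv ρ) := Measure.measurable_rnDeriv _ _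
    have mi : Measurable[mX] ({x | (σ.trim hG).rnDeriv (ρ.trim hG) x = 0}.indicator
        (1 : X → ℝ≥0∞)) := (measurable_one.indicator mS).mono hG le_rfl
    have mp : Measurable[mX] fun x => σ.rnDeriv ρ x *
        {x | (σ.trim hG).rnDeriv (ρ.trim hG) x = 0}.indicator (1 : X → ℝ≥0∞) x := ms.mul mi
    rw [lintegral_eq_zero_iff mp] at this
    filter_upwards [this] with x hx h
    simpa [Set.indicator, h] using hx
  rw [hellingerIntegral_eq_lintegral (ρ := ρ.trim hG) mf' mg'
    (withDensity_rnDeriv_trim hG hμρ) (withDensity_rnDeriv_trim hG hνρ) h0 h1, hellingerIntegral,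
    ← hρ]
  set S := {x | f' x ≠ 0 ∧ g' x ≠ 0} with hS
  have mS : MeasurableSet[G] S :=
    (mf' (measurableSet_singleton 0)).compl.inter (mg' (measurableSet_singleton 0)).compl
  -- The tangent bound needs nonzero `f'` and `g'`, hence the cut to `S`. Off `S` the fine integrand
  -- vanishes by `hzero`.
  set h : X → ℝ≥0∞ := S.indicator fun x => f' x ^ α * g' x ^ (1 - α) with hh
  have mh : Measurable[G] h := ((mf'.pow_const _).mul (mg'.pow_const _)).indicator mS
  have tf' : ∀ᵐ x ∂ρ, f' x < ∞ := ae_of_ae_trim hG (Measure.rnDeriv_lt_top _ _)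
  have tg' : ∀ᵐ x ∂ρ, g' x < ∞ := ae_of_ae_trim hG (Measure.rnDeriv_lt_top _ _)
  have step : ∀ (k' : X → ℝ≥0∞), ∫⁻ x, k' x * (h x / k' x) ∂(ρ.trim hG) ≤
        ∫⁻ x, f' x ^ α * g' x ^ (1 - α) ∂(ρ.trim hG) := by
    intro k'
    refine lintegral_mono fun x => ?_
    refine ENNReal.mul_div_le.trans ?_
    by_cases hx : x ∈ S <;> simp [hh, hx]
  calc ∫⁻ x, f x ^ α * g x ^ (1 - α) ∂ρ
      ≤ ∫⁻ x, (ENNReal.ofReal α * (f x * (h x / f' x))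
          + ENNReal.ofReal (1 - α) * (g x * (h x / g' x))) ∂ρ := by
        refine lintegral_mono_ae ?_
        filter_upwards [hzero μ hμρ, hzero ν hνρ, tf', tg', Measure.rnDeriv_lt_top μ ρ,
          Measure.rnDeriv_lt_top ν ρ] with x z1 z2 t1 t2 t3 t4
        by_cases hx : x ∈ S
        · refine (ENNReal_young h0 h1 hx.1 t1.ne hx.2 t2.ne t3.ne t4.ne).trans (le_of_eq ?_)
          simp only [hh, hx, Set.indicator_of_mem, div_eq_mul_inv]
          ring
        · by_cases hx1 : f' x = 0
          · simp [f, z1 hx1, h0]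
          · have hx2 : g' x = 0 := by
              by_contra h'; exact hx ⟨hx1, h'⟩
            simp [g, z2 hx2, h1']
    _ = ENNReal.ofReal α * ∫⁻ x, f x * (h x / f' x) ∂ρ
          + ENNReal.ofReal (1 - α) * ∫⁻ x, g x * (h x / g' x) ∂ρ := by
        have m1 : Measurable[mX] fun x => h x / f' x := (mh.div mf').mono hG le_rfl
        have m2 : Measurable[mX] fun x => h x / g' x := (mh.div mg').mono hG le_rfl
        rw [lintegral_add_left (by fun_prop), lintegral_const_mul _ (by fun_prop),
          lintegral_const_mul _ (by fun_prop)]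
    _ ≤ ENNReal.ofReal α * ∫⁻ x, f' x ^ α * g' x ^ (1 - α) ∂(ρ.trim hG)
          + ENNReal.ofReal (1 - α) * ∫⁻ x, f' x ^ α * g' x ^ (1 - α) ∂(ρ.trim hG) := by
        rw [key μ hμρ (fun x => h x / f' x) (mh.div mf'), key ν hνρ (fun x => h x / g' x) (mh.div mg')]
        gcongr ENNReal.ofReal α * ?_ + ENNReal.ofReal (1 - α) * ?_
        · exact step f'
        · exact step g'
    _ = ∫⁻ x, f' x ^ α * g' x ^ (1 - α) ∂(ρ.trim hG) := by
        rw [← add_mul, ← ENNReal.ofReal_add h0.le h1'.le]; simp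

theorem rnDeriv_add_le_one (μ ν : Measure X) [IsFiniteMeasure μ] [IsFiniteMeasure ν] :
    ∀ᵐ x ∂(μ + ν), μ.rnDeriv (μ + ν) x ≤ 1 :=
  Measure.rnDeriv_le_one_of_le (Measure.le_add_right le_rfl)

/-- Martingale convergence for the Hellinger integrals along a filtration. -/
theorem tendsto_hellingerIntegral_trim [IsFiniteMeasure μ] [IsFiniteMeasure ν]
    (G : Filtration ℕ mX) (hG : ⨆ n, G n = mX) (h0 : 0 < α) (h1 : α < 1) :
    Tendsto (fun n => hellingerIntegral α (μ.trim (G.le n)) (ν.trim (G.le n))) atTop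
      (𝓝 (hellingerIntegral α μ ν)) := by
  have h1' : 0 < 1 - α := by linarith
  set ρ := μ + ν with hρ
  have hμρ : μ ≪ ρ := Measure.AbsolutelyContinuous.rfl.add_right _
  have hνρ : ν ≪ ρ := Measure.AbsolutelyContinuous.rfl.add_right' _
  have e : ∀ n, hellingerIntegral α (μ.trim (G.le n)) (ν.trim (G.le n)) =
      ∫⁻ x, (μ.trim (G.le n)).rnDeriv (ρ.trim (G.le n)) x ^ α *
        (ν.trim (G.le n)).rnDeriv (ρ.trim (G.le n)) x ^ (1 - α) ∂ρ := by
    intro n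
    rw [hellingerIntegral_eq_lintegral (ρ := ρ.trim (G.le n)) (Measure.measurable_rnDeriv _ _)
      (Measure.measurable_rnDeriv _ _)
      (withDensity_rnDeriv_trim (G.le n) hμρ) (withDensity_rnDeriv_trim (G.le n) hνρ) h0 h1,
      lintegral_trim]
    exact ((Measure.measurable_rnDeriv _ _).pow_const _).mul
      ((Measure.measurable_rnDeriv _ _).pow_const _)
  -- Lévy's upward theorem, applied to the real-valued densities relative to μ + ν. These are at
  -- most 1, which also supplies the dominating constant.
  have conv : ∀ (σ : Measure X) [IsFiniteMeasure σ], σ ≪ ρ → ∀ᵐ x ∂ρ,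
      Tendsto (fun n => (σ.trim (G.le n)).rnDeriv (ρ.trim (G.le n)) x) atTop
        (𝓝 (σ.rnDeriv ρ x)) := by
    intro σ _ hσ
    have H1 := (Measure.integrable_toReal_rnDeriv (μ := σ) (ν := ρ)).tendsto_ae_condExp (ℱ := G)
      (by rw [hG]; exact (Measure.measurable_rnDeriv _ _).ennreal_toReal.stronglyMeasurable)
    have H2 : ∀ᵐ x ∂ρ, ∀ n, ((σ.trim (G.le n)).rnDeriv (ρ.trim (G.le n)) x).toReal
        = (ρ[fun x => (σ.rnDeriv ρ x).toReal | G n]) x :=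
      ae_all_iff.2 fun n => ae_of_ae_trim (G.le n) (toReal_rnDeriv_trim (G.le n) hσ)
    have H3 : ∀ᵐ x ∂ρ, ∀ n, (σ.trim (G.le n)).rnDeriv (ρ.trim (G.le n)) x < ∞ :=
      ae_all_iff.2 fun n => ae_of_ae_trim (G.le n) (Measure.rnDeriv_lt_top _ _)
    filter_upwards [H1, H2, H3, Measure.rnDeriv_lt_top σ ρ] with x h1 h2 h3 h4
    rw [← ENNReal.tendsto_toReal_iff (fun n => (h3 n).ne) h4.ne]
    simpa only [h2] using h1
  have bound : ∀ (σ : Measure X) [IsFiniteMeasure σ], σ ≤ ρ → ∀ᵐ x ∂ρ,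
      ∀ n, (σ.trim (G.le n)).rnDeriv (ρ.trim (G.le n)) x ≤ 1 := by
    intro σ _ hσ
    exact ae_all_iff.2 fun n => ae_of_ae_trim (G.le n)
      (Measure.rnDeriv_le_one_of_le (Measure.le_iff.2 fun s hs => by
        rw [trim_measurableSet_eq _ hs, trim_measurableSet_eq _ hs]; exact hσ s))
  simp only [e]
  refine tendsto_lintegral_of_dominated_convergence (fun _ => 1) ?_ ?_ ?_ ?_
  · intro n
    have a := (Measure.measurable_rnDeriv (μ.trim (G.le n)) (ρ.trim (G.le n))).mono (G.le n) le_rfl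
    have b := (Measure.measurable_rnDeriv (ν.trim (G.le n)) (ρ.trim (G.le n))).mono (G.le n) le_rfl
    fun_prop
  · intro n
    filter_upwards [bound μ (Measure.le_add_right le_rfl), bound ν (Measure.le_add_left le_rfl)]
      with x b1 b2
    exact mul_le_one' (ENNReal.rpow_le_one (b1 n) h0.le) (ENNReal.rpow_le_one (b2 n) h1'.le)
  · simp
  · filter_upwards [conv μ hμρ, conv ν hνρ, Measure.rnDeriv_lt_top μ ρ,
      Measure.rnDeriv_lt_top ν ρ] with x c1 c2 t1 t2
    refine ENNReal.Tendsto.mul ?_ (Or.inr ?_) ?_ (Or.inr ?_)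
    · exact (ENNReal.continuous_rpow_const.tendsto _).comp c1
    · exact ENNReal.rpow_ne_top_of_nonneg h1'.le t2.ne
    · exact (ENNReal.continuous_rpow_const.tendsto _).comp c2
    · exact ENNReal.rpow_ne_top_of_nonneg h0.le t1.ne

/-- As `α → 1`, the Hellinger integrals converge to the mass of the absolutely continuous part. -/
theorem tendsto_hellingerIntegral_one (μ ν : Measure X) [IsFiniteMeasure μ] [IsFiniteMeasure ν] :
    Tendsto (fun α => hellingerIntegral α μ ν) (𝓝[<] 1) (𝓝 (acPart μ ν Set.univ)) := by
  set ρ := μ + ν with hρ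
  have hνρ : ν ≪ ρ := Measure.AbsolutelyContinuous.rfl.add_right' _
  have mf : Measurable (μ.rnDeriv ρ) := Measure.measurable_rnDeriv _ _
  have mg : Measurable (ν.rnDeriv ρ) := Measure.measurable_rnDeriv _ _
  have ea : acPart μ ν Set.univ
      = ∫⁻ x, ν.rnDeriv ρ x * (μ.rnDeriv ρ x / ν.rnDeriv ρ x) ∂ρ := by
    rw [acPart, withDensity_apply _ .univ, Measure.restrict_univ,
      lintegral_congr_ae (Measure.rnDeriv_eq_div_rnDeriv_add μ ν), ← hρ,
      lintegral_rnDeriv_mul hνρ (by fun_prop)]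
  have hI : ∀ᶠ α : ℝ in 𝓝[<] 1, α ∈ Set.Ioo (0 : ℝ) 1 :=
    Ioo_mem_nhdsLT one_pos
  rw [ea]
  refine tendsto_lintegral_filter_of_dominated_convergence (fun _ => 1) ?_ ?_ ?_ ?_
  · exact Eventually.of_forall fun α => by fun_prop
  · filter_upwards [hI] with α hα
    filter_upwards [rnDeriv_add_le_one μ ν, (add_comm ν μ ▸ rnDeriv_add_le_one ν μ :
      ∀ᵐ x ∂(μ + ν), ν.rnDeriv (μ + ν) x ≤ 1)] with x b1 b2
    exact mul_le_one' (ENNReal.rpow_le_one b1 hα.1.le)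
      (ENNReal.rpow_le_one b2 (by linarith [hα.2]))
  · simp
  · filter_upwards [Measure.rnDeriv_lt_top μ ρ, Measure.rnDeriv_lt_top ν ρ] with x t1 t2
    -- The singular part is lost here: the exponent 1 - α is positive along the approach, so the
    -- factor is 0^(1-α) = 0, although 0^0 = 1 at α = 1 itself.
    by_cases hg : ν.rnDeriv ρ x = 0
    · rw [hg]
      simp only [zero_mul]
      refine tendsto_const_nhds.congr' ?_
      filter_upwards [hI] with α hα
      rw [ ENNReal.zero_rpow_of_pos (by linarith [hα.2]), mul_zero]
    · rw [ENNReal.mul_div_cancel hg t2.ne]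
      by_cases hf : μ.rnDeriv ρ x = 0
      · rw [hf]
        refine tendsto_const_nhds.congr' ?_
        filter_upwards [hI] with α hα
        rw [ ENNReal.zero_rpow_of_pos hα.1, zero_mul]
      · rw [← hρ]
        have hlim : ∀ c : ℝ≥0∞, c ≠ 0 → c ≠ ∞ → ∀ u : ℝ → ℝ, ∀ a, Tendsto u (𝓝[<] 1) (𝓝 a) →
            Tendsto (fun α => c ^ u α) (𝓝[<] 1) (𝓝 (c ^ a)) := by
          intro c hc hc' u a hu
          lift c to ℝ≥0 using hc'
          have hc0 : c ≠ 0 := by simpa using hc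
          simp only [← ENNReal.coe_rpow_of_ne_zero hc0]
          exact ENNReal.tendsto_coe.2 (tendsto_const_nhds.nnrpow hu (Or.inl hc0))
        have l1 := hlim _ hf t1.ne (fun α => α) 1 (tendsto_nhdsWithin_of_tendsto_nhds tendsto_id)
        have l2 := hlim _ hg t2.ne (fun α => 1 - α) (1 - 1)
          (tendsto_nhdsWithin_of_tendsto_nhds (tendsto_const_nhds.sub tendsto_id))
        have := ENNReal.Tendsto.mul l1 (Or.inr (by simp)) l2 (Or.inr (by simpa using t1.ne))
        simpa using this

end Generic
theorem hellingerIntegral_eq_lintegral_of_trim {X : Type*} {G mX : MeasurableSpace X} (hG : G ≤ mX)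
    {ρ : @Measure X mX} {μ ν : @Measure X G} [IsFiniteMeasure μ] [IsFiniteMeasure ν]
    {f g : X → ℝ≥0∞} (hf : Measurable[G] f) (hg : Measurable[G] g)
    (hμ : (ρ.trim hG).withDensity f = μ) (hν : (ρ.trim hG).withDensity g = ν)
    {α : ℝ} (h0 : 0 < α) (h1 : α < 1) :
    hellingerIntegral α μ ν = ∫⁻ x, f x ^ α * g x ^ (1 - α) ∂ρ := by
  rw [hellingerIntegral_eq_lintegral hf hg hμ hν h0 h1]
  exact lintegral_trim hG ((hf.pow_const _).mul (hg.pow_const _))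

/-! ### Gluing σ-algebras along a finite partition -/

section Cells

variable {X ι : Type*} {mX : MeasurableSpace X} {E : ι → Set X} {𝓕 : ι → MeasurableSpace X}

/-- The σ-algebra of the sets whose trace on each cell `E i` is the trace of a set of `𝓕 i`. -/
@[reducible] def cellSigma (E : ι → Set X) (𝓕 : ι → MeasurableSpace X) : MeasurableSpace X :=
  ⨅ i, ((𝓕 i).comap (Subtype.val : E i → X)).map Subtype.val

theorem measurableSet_cellSigma {A : Set X} : MeasurableSet[cellSigma E 𝓕] A ↔
    ∀ i, ∃ B, MeasurableSet[𝓕 i] B ∧ A ∩ E i = B ∩ E i := by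
  rw [MeasurableSpace.measurableSet_iInf]
  refine forall_congr' fun i => ?_
  change (∃ B, MeasurableSet[𝓕 i] B ∧ Subtype.val ⁻¹' B = Subtype.val ⁻¹' A) ↔ _
  refine exists_congr fun B => and_congr_right fun _ => ?_
  rw [Subtype.preimage_val_eq_preimage_val_iff, Set.inter_comm, eq_comm, Set.inter_comm A]

theorem iUnion_inter_cells (hU : ⋃ i, E i = Set.univ) (A : Set X) : ⋃ i, A ∩ E i = A := by
  rw [← Set.inter_iUnion, hU, Set.inter_univ]

variable [Fintype ι]

theorem measurable_glue (hd : Pairwise (Function.onFun Disjoint E)) {f : ι → X → ℝ≥0∞}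
    (hf : ∀ i, Measurable[𝓕 i] (f i)) :
    Measurable[cellSigma E 𝓕] fun x => ∑ i, (E i).indicator (f i) x := by
  refine @Finset.measurable_sum _ _ _ _ _ _ (cellSigma E 𝓕) _ _ fun i _ => ?_
  intro S hS
  rw [measurableSet_cellSigma]
  intro j
  by_cases h : j = i
  · subst h
    refine ⟨f j ⁻¹' S, hf j hS, ?_⟩
    ext x
    simp +contextual [Set.indicator]
  -- On a cell other than `E i` the summand is 0, so the preimage under the zero function has the
  -- required trace.
  · refine ⟨(fun _ => 0) ⁻¹' S, @measurable_const _ _ _ (𝓕 j) 0 _ hS, ?_⟩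
    ext x
    simp only [Set.mem_inter_iff, Set.mem_preimage]
    refine and_congr_left fun hx => ?_
    rw [Set.indicator_of_notMem fun hx' => (hd h).le_bot ⟨hx, hx'⟩]

/-- A set of the glued σ-algebra can be replaced on each cell by a set of `𝓕 i`, where the local
density applies. Restricting ρ to the cell makes this work without `E i` belonging to `𝓕 i`. -/
theorem withDensity_glue (hE : ∀ i, MeasurableSet[mX] (E i)) (h𝓕 : ∀ i, 𝓕 i ≤ mX)
    (hd : Pairwise (Function.onFun Disjoint E)) (hU : ⋃ i, E i = Set.univ)
    (hG : cellSigma E 𝓕 ≤ mX) {ρ σ : @Measure X mX} {f : ι → X → ℝ≥0∞}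
    (hf : ∀ i, Measurable[𝓕 i] (f i))
    (h : ∀ i, ((ρ.restrict (E i)).trim (h𝓕 i)).withDensity (f i)
      = (σ.restrict (E i)).trim (h𝓕 i)) :
    (ρ.trim hG).withDensity (fun x => ∑ i, (E i).indicator (f i) x) = σ.trim hG := by
  have hfm : ∀ i, Measurable[mX] (f i) := fun i => (hf i).mono (h𝓕 i) le_rfl
  refine @Measure.ext _ (cellSigma E 𝓕) _ _ fun A hA => ?_
  rw [withDensity_apply _ hA, restrict_trim _ _ hA, lintegral_trim _ (measurable_glue hd hf),
    trim_measurableSet_eq _ hA, lintegral_finsetSum _ fun i _ => (hfm i).indicator (hE i)]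
  conv_rhs => rw [← iUnion_inter_cells hU A]
  rw [measure_iUnion (fun i j hij => ((hd hij).mono Set.inter_subset_right Set.inter_subset_right))
    (fun i => (hG _ hA).inter (hE i)), tsum_fintype]
  refine Finset.sum_congr rfl fun i _ => ?_
  obtain ⟨B, hB, hAB⟩ := measurableSet_cellSigma.1 hA i
  have := congrArg (fun τ => τ B) (h i)
  rw [withDensity_apply _ hB, restrict_trim _ _ hB, lintegral_trim _ (hf i),
    trim_measurableSet_eq _ hB, Measure.restrict_restrict (h𝓕 i _ hB),
    Measure.restrict_apply (h𝓕 i _ hB)] at this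
  rw [lintegral_indicator (hE i), Measure.restrict_restrict (hE i), Set.inter_comm (E i), hAB, this]

theorem glue_apply (hd : Pairwise (Function.onFun Disjoint E)) (f : ι → X → ℝ≥0∞) {i : ι} {x : X}
    (hx : x ∈ E i) : ∑ j, (E j).indicator (f j) x = f i x := by
  classical
  rw [Finset.sum_eq_single i, Set.indicator_of_mem hx]
  · intro j _ hj
    rw [Set.indicator_of_notMem fun hx' => (hd hj).le_bot ⟨hx', hx⟩]
  · simp

/-- The Hellinger integral on `cellSigma E 𝓕` is the sum of those on the cells. -/
theorem hellingerIntegral_cellSigma (hE : ∀ i, MeasurableSet[mX] (E i)) (h𝓕 : ∀ i, 𝓕 i ≤ mX)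
    (hd : Pairwise (Function.onFun Disjoint E)) (hU : ⋃ i, E i = Set.univ)
    (hG : cellSigma E 𝓕 ≤ mX) {μ ν : @Measure X mX} [IsFiniteMeasure μ] [IsFiniteMeasure ν]
    {α : ℝ} (h0 : 0 < α) (h1 : α < 1) :
    hellingerIntegral α (μ.trim hG) (ν.trim hG) = ∑ i, hellingerIntegral α
      ((μ.restrict (E i)).trim (h𝓕 i)) ((ν.restrict (E i)).trim (h𝓕 i)) := by
  set ρ := μ + ν with hρ
  set f : ι → X → ℝ≥0∞ := fun i => ((μ.restrict (E i)).trim (h𝓕 i)).rnDeriv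
    ((ρ.restrict (E i)).trim (h𝓕 i)) with hf
  set g : ι → X → ℝ≥0∞ := fun i => ((ν.restrict (E i)).trim (h𝓕 i)).rnDeriv
    ((ρ.restrict (E i)).trim (h𝓕 i)) with hg
  have mf : ∀ i, Measurable[𝓕 i] (f i) := fun i => Measure.measurable_rnDeriv _ _
  have mg : ∀ i, Measurable[𝓕 i] (g i) := fun i => Measure.measurable_rnDeriv _ _
  have df : ∀ i, ((ρ.restrict (E i)).trim (h𝓕 i)).withDensity (f i)
      = (μ.restrict (E i)).trim (h𝓕 i) := fun i => withDensity_rnDeriv_trim _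
    ((Measure.AbsolutelyContinuous.rfl.add_right _).restrict _)
  have dg : ∀ i, ((ρ.restrict (E i)).trim (h𝓕 i)).withDensity (g i)
      = (ν.restrict (E i)).trim (h𝓕 i) := fun i => withDensity_rnDeriv_trim _
    ((Measure.AbsolutelyContinuous.rfl.add_right' _).restrict _)
  have hGf := measurable_glue hd mf
  have hGg := measurable_glue hd mg
  have mh : ∀ i, Measurable[𝓕 i] fun x => f i x ^ α * g i x ^ (1 - α) :=
    fun i => ((mf i).pow_const _).mul ((mg i).pow_const _)
  rw [hellingerIntegral_eq_lintegral_of_trim hG hGf hGg (withDensity_glue hE h𝓕 hd hU hG mf df)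
    (withDensity_glue hE h𝓕 hd hU hG mg dg) h0 h1]
  -- Each point lies in exactly one cell, so the powers pass inside the sums.
  have e : ∀ x, (∑ i, (E i).indicator (f i) x) ^ α * (∑ i, (E i).indicator (g i) x) ^ (1 - α)
      = ∑ i, (E i).indicator (fun x => f i x ^ α * g i x ^ (1 - α)) x := by
    intro x
    obtain ⟨i, hi⟩ := Set.mem_iUnion.1 (hU.symm ▸ Set.mem_univ x : x ∈ ⋃ i, E i)
    rw [glue_apply hd f hi, glue_apply hd g hi, glue_apply hd _ hi]
  simp only [e]
  rw [lintegral_finsetSum _ fun i _ => ((mh i).mono (h𝓕 i) le_rfl).indicator (hE i)]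
  refine Finset.sum_congr rfl fun i _ => ?_
  rw [lintegral_indicator (hE i),
    hellingerIntegral_eq_lintegral_of_trim (h𝓕 i) (mf i) (mg i) (df i) (dg i) h0 h1]

end Cells

/-! ### Densities relative to P on a cell -/

section Density

variable {Ω : Type*} {m : MeasurableSpace Ω}

/-- `X` is a density relative to `P`, on the σ-algebra `G`, of the measure `A ↦ μ (A ∩ E)`. -/
structure IsCellDensity (G : MeasurableSpace Ω) (μ P : @Measure Ω m) (E : Set Ω) (X : Ω → ℝ) :
    Prop where
  measurable : Measurable[G] X
  nonneg : 0 ≤ᵐ[P] X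
  setLIntegral : ∀ B, MeasurableSet[G] B → ∫⁻ ω in B, ENNReal.ofReal (X ω) ∂P = μ (B ∩ E)

theorem IsCellDensity.withDensity {G : MeasurableSpace Ω} (hG : G ≤ m) {μ P : @Measure Ω m}
    {E : Set Ω} {X : Ω → ℝ} (h : IsCellDensity G μ P E X) :
    (P.trim hG).withDensity (fun ω => ENNReal.ofReal (X ω)) = (μ.restrict E).trim hG := by
  refine @Measure.ext _ G _ _ fun A hA => ?_
  rw [withDensity_apply _ hA, restrict_trim _ _ hA, lintegral_trim _ h.measurable.ennreal_ofReal,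
    trim_measurableSet_eq _ hA, h.setLIntegral A hA, Measure.restrict_apply (hG _ hA)]

theorem IsCellDensity.hellingerIntegral_eq {G : MeasurableSpace Ω} (hG : G ≤ m)
    {μ ν P : @Measure Ω m} [IsFiniteMeasure μ] [IsFiniteMeasure ν]
    {E : Set Ω} {X Y : Ω → ℝ} (hX : IsCellDensity G μ P E X) (hY : IsCellDensity G ν P E Y)
    {α : ℝ} (h0 : 0 < α) (h1 : α < 1) :
    hellingerIntegral α ((μ.restrict E).trim hG) ((ν.restrict E).trim hG)
      = ∫⁻ ω, ENNReal.ofReal (X ω ^ α * Y ω ^ (1 - α)) ∂P := by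
  rw [hellingerIntegral_eq_lintegral_of_trim hG hX.measurable.ennreal_ofReal
    hY.measurable.ennreal_ofReal (hX.withDensity hG) (hY.withDensity hG) h0 h1]
  refine lintegral_congr_ae ?_
  filter_upwards [hX.nonneg, hY.nonneg] with ω hx hy
  rw [ENNReal.ofReal_rpow_of_nonneg hx h0.le, ENNReal.ofReal_rpow_of_nonneg hy (by linarith),
    ENNReal.ofReal_mul (Real.rpow_nonneg hx _)]

variable {F : Filtration ℝ≥0 m} {μ P : Measure Ω} {z : ℝ≥0 → Ω → ℝ}

theorem IsDensityProcess.isCellDensity_univ [IsFiniteMeasure μ] [IsFiniteMeasure P]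
    (hz : IsDensityProcess F μ P z) (hμ : LocallyAC F μ P) (t : ℝ≥0) :
    IsCellDensity (F t) μ P Set.univ (z t) := by
  refine ⟨(hz.adapted t).measurable, ?_, fun B hB => ?_⟩
  · filter_upwards [ae_of_ae_trim (F.le t) (hz.ae_eq t)] with ω h
    rw [h]; exact ENNReal.toReal_nonneg
  · have e : ∀ᵐ ω ∂P, ENNReal.ofReal (z t ω)
        = (μ.trim (F.le t)).rnDeriv (P.trim (F.le t)) ω := by
      filter_upwards [ae_of_ae_trim (F.le t) (hz.ae_eq t), ae_of_ae_trim (F.le t)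
        (Measure.rnDeriv_lt_top (μ.trim (F.le t)) (P.trim (F.le t)))] with ω h h'
      rw [h, ENNReal.ofReal_toReal h'.ne]
    rw [lintegral_congr_ae (ae_restrict_of_ae e), Set.inter_univ,
      ← lintegral_trim (F.le t) (Measure.measurable_rnDeriv _ _) (μ := P.restrict B),
      ← restrict_trim _ _ hB, Measure.setLIntegral_rnDeriv (hμ t), trim_measurableSet_eq _ hB]

theorem IsCellDensity.indicator {G : MeasurableSpace Ω} (hG : G ≤ m)
    {μ P : @Measure Ω m} {X : Ω → ℝ} {E : Set Ω}
    (h : IsCellDensity G μ P Set.univ X) (hE : MeasurableSet[G] E) :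
    IsCellDensity G μ P E (E.indicator X) := by
  refine ⟨h.measurable.indicator hE, ?_, fun B hB => ?_⟩
  · filter_upwards [h.nonneg] with ω hω
    exact Set.indicator_apply_nonneg fun _ => hω
  · have e : ∀ ω, ENNReal.ofReal (E.indicator X ω)
        = E.indicator (fun ω => ENNReal.ofReal (X ω)) ω := by
      intro ω; by_cases hx : ω ∈ E <;> simp [hx]
    simp only [e]
    rw [lintegral_indicator (hG _ hE), Measure.restrict_restrict (hG _ hE),
      h.setLIntegral _ (hE.inter hB), Set.inter_univ, Set.inter_comm]

/-- Conditioning preserves integrals over sets of `G`, and `E` enters only through μ (B ∩ E), so `E`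
need not lie in `G`. This is the source of the conditional expectations in the formula: a strip is
known at its right endpoint, while its σ-algebra is taken at the left one. -/
theorem IsCellDensity.condExp {G H : MeasurableSpace Ω} (hGH : G ≤ H) (hH : H ≤ m)
    {μ P : @Measure Ω m} [IsFiniteMeasure μ] [IsFiniteMeasure P] {X : Ω → ℝ} {E : Set Ω}
    (h : IsCellDensity H μ P E X) : IsCellDensity G μ P E (P[X | G]) := by
  have hG : G ≤ m := hGH.trans hH
  have hXm : Measurable[m] X := h.measurable.mono hH le_rfl
  have hint : Integrable X P := by
    refine ⟨hXm.aestronglyMeasurable, ?_⟩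
    rw [hasFiniteIntegral_iff_ofReal h.nonneg, ← setLIntegral_univ, h.setLIntegral _ .univ]
    exact measure_lt_top _ _
  have hnn : 0 ≤ᵐ[P] P[X | G] := condExp_nonneg h.nonneg
  refine ⟨stronglyMeasurable_condExp.measurable, hnn, fun B hB => ?_⟩
  rw [← ofReal_integral_eq_lintegral_ofReal integrable_condExp.integrableOn (ae_restrict_of_ae hnn),
    setIntegral_condExp hG hint hB,
    ofReal_integral_eq_lintegral_ofReal hint.integrableOn (ae_restrict_of_ae h.nonneg),
    h.setLIntegral B (hGH _ hB)]

end Density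

/-! ### Dyadic cells of T and their convergence to 𝓕_{T-} -/

section Dyadic

variable {Ω : Type*} {m : MeasurableSpace Ω} {F : Filtration ℝ≥0 m} {T : Ω → WithTop ℝ≥0}

/-- The index of the cell of level `n` containing `ω`: the least `k` with `T ω ≤ k / 2 ^ n` if
`T ω ≤ n`, and `n 2 ^ n + 1` otherwise. -/
noncomputable def dyadicIndex (T : Ω → WithTop ℝ≥0) (n : ℕ) (ω : Ω) : ℕ :=
  if T ω = ⊤ then n * 2 ^ n + 1 else min (n * 2 ^ n + 1) ⌈(T ω).untopD 0 * 2 ^ n⌉₊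

theorem dyadicIndex_lt (n : ℕ) (ω : Ω) : dyadicIndex T n ω < n * 2 ^ n + 2 := by
  unfold dyadicIndex
  split_ifs <;> omega

theorem dyadicIndex_le_iff {n k : ℕ} (hk : k ≤ n * 2 ^ n) (ω : Ω) :
    dyadicIndex T n ω ≤ k ↔ T ω ≤ (dyadicTime n k : WithTop ℝ≥0) := by
  unfold dyadicIndex dyadicTime
  rcases h : T ω with _ | t
  · change (if (⊤ : WithTop ℝ≥0) = ⊤ then _ else _) ≤ k ↔ (⊤ : WithTop ℝ≥0) ≤ _
    rw [if_pos rfl]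
    simp only [top_le_iff, WithTop.coe_ne_top, iff_false]
    omega
  · change (if (t : WithTop ℝ≥0) = ⊤ then _ else min _ ⌈t * 2 ^ n⌉₊) ≤ k ↔ (t : WithTop ℝ≥0) ≤ _
    rw [if_neg (WithTop.coe_ne_top), WithTop.coe_le_coe, le_div_iff₀ (by positivity), ← Nat.ceil_le]
    omega

theorem ceil_mul_two_pow_succ (t : ℝ≥0) (n : ℕ) :
    ⌈t * 2 ^ n⌉₊ = (⌈t * 2 ^ (n + 1)⌉₊ + 1) / 2 := by
  refine eq_of_forall_ge_iff fun k => ?_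
  have : (⌈t * 2 ^ (n + 1)⌉₊ + 1) / 2 ≤ k ↔ ⌈t * 2 ^ (n + 1)⌉₊ ≤ k * 2 := by omega
  rw [this, Nat.ceil_le, Nat.ceil_le, pow_succ, ← mul_assoc]
  push_cast
  exact (mul_le_mul_iff_left₀ two_pos).symm

/-- The cells are nested: halving the index and rounding up gives the parent cell, with everything
beyond time n merged into the last one. -/
theorem dyadicIndex_eq_succ (n : ℕ) (ω : Ω) :
    dyadicIndex T n ω = min (n * 2 ^ n + 1) ((dyadicIndex T (n + 1) ω + 1) / 2) := by
  unfold dyadicIndex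
  have h : (n + 1) * 2 ^ (n + 1) = 2 * (n * 2 ^ n) + 2 * 2 ^ n := by ring
  split_ifs
  · omega
  · rw [ceil_mul_two_pow_succ]
    omega

theorem dyadicTime_mono_right (n : ℕ) : Monotone (dyadicTime n) := fun a b h => by
  unfold dyadicTime
  gcongr

theorem dyadicTime_succ (n k : ℕ) : dyadicTime n k = dyadicTime (n + 1) (2 * k) := by
  unfold dyadicTime
  rw [pow_succ]
  push_cast
  field_simp

theorem dyadicTime_mul_two_pow (n : ℕ) : dyadicTime n (n * 2 ^ n) = n := by
  unfold dyadicTime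
  push_cast
  field_simp

/-- The cells of level `n`. -/
def dyadicCell (T : Ω → WithTop ℝ≥0) (n : ℕ) (k : Fin (n * 2 ^ n + 2)) : Set Ω :=
  {ω | dyadicIndex T n ω = k}

/-- The σ-algebra on the cell of index `k`. -/
@[reducible] noncomputable def dyadicSigma (F : Filtration ℝ≥0 m) (n : ℕ) (k : Fin (n * 2 ^ n + 2)) : MeasurableSpace Ω :=
  F (dyadicTime n (k - 1))

theorem pairwise_disjoint_dyadicCell (n : ℕ) :
    Pairwise (Function.onFun Disjoint (dyadicCell T n)) := fun _ _ hij =>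
  Set.disjoint_left.2 fun _ hi hj => hij (Fin.ext (hi.symm.trans hj))

theorem iUnion_dyadicCell (n : ℕ) : ⋃ k, dyadicCell T n k = Set.univ :=
  Set.eq_univ_of_forall fun ω => Set.mem_iUnion.2 ⟨⟨_, dyadicIndex_lt n ω⟩, rfl⟩

theorem dyadicCell_of_eq_zero {n : ℕ} {k : Fin (n * 2 ^ n + 2)} (hk : (k : ℕ) = 0) :
    dyadicCell T n k = {ω | T ω = 0} := by
  ext ω
  have := dyadicIndex_le_iff (T := T) (Nat.zero_le (n * 2 ^ n)) ω
  have e : ((dyadicTime n 0 : ℝ≥0) : WithTop ℝ≥0) = 0 := by simp [dyadicTime]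
  have hb : (0 : WithTop ℝ≥0) = ⊥ := rfl
  rw [e, Nat.le_zero, hb, le_bot_iff, ← hb] at this
  simpa [dyadicCell, hk] using this

theorem dyadicCell_of_le {n : ℕ} {k : Fin (n * 2 ^ n + 2)} (hk : (k : ℕ) ≠ 0)
    (hk' : (k : ℕ) ≤ n * 2 ^ n) : dyadicCell T n k = dyadicEvent T n k := by
  ext ω
  have h1 := dyadicIndex_le_iff (T := T) hk' ω
  have h2 := dyadicIndex_le_iff (T := T) (show (k : ℕ) - 1 ≤ n * 2 ^ n by omega) ω
  simp only [dyadicCell, dyadicEvent, Set.mem_ofPred_eq]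
  rw [← h1, ← not_le, ← h2]
  omega

theorem dyadicCell_of_eq_succ {n : ℕ} {k : Fin (n * 2 ^ n + 2)} (hk : (k : ℕ) = n * 2 ^ n + 1) :
    dyadicCell T n k = {ω | ((n : ℝ≥0) : WithTop ℝ≥0) < T ω} := by
  ext ω
  have h1 := dyadicIndex_le_iff (T := T) (le_refl (n * 2 ^ n)) ω
  have h2 := dyadicIndex_lt (T := T) n ω
  simp only [dyadicCell, Set.mem_ofPred_eq]
  rw [← dyadicTime_mul_two_pow n, ← not_le, ← h1]
  omega

theorem measurableSet_leftSigma_of_zero {A : Set Ω} (hA : MeasurableSet[F 0] A) :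
    MeasurableSet[leftSigma F T] A :=
  MeasurableSpace.measurableSet_generateFrom (Or.inl hA)

theorem measurableSet_leftSigma_inter {t : ℝ≥0} {A : Set Ω} (hA : MeasurableSet[F t] A) :
    MeasurableSet[leftSigma F T] (A ∩ {ω | (t : WithTop ℝ≥0) < T ω}) :=
  MeasurableSpace.measurableSet_generateFrom (Or.inr ⟨t, A, hA, rfl⟩)

theorem measurableSet_leftSigma_lt (t : ℝ≥0) :
    MeasurableSet[leftSigma F T] {ω | (t : WithTop ℝ≥0) < T ω} := by
  simpa using measurableSet_leftSigma_inter (F := F) (T := T) (t := t)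
    (@MeasurableSet.univ _ (F t))

theorem measurableSet_inter_dyadicCell {n : ℕ} {k : Fin (n * 2 ^ n + 2)} {B : Set Ω}
    (hB : MeasurableSet[dyadicSigma F n k] B) :
    MeasurableSet[leftSigma F T] (B ∩ dyadicCell T n k) := by
  unfold dyadicSigma at hB
  by_cases h0 : (k : ℕ) = 0
  · rw [h0] at hB
    -- Truncated subtraction gives the cell {T = 0} the σ-algebra at time 0.
    have e : dyadicTime n (0 - 1) = 0 := by simp [dyadicTime]
    rw [e] at hB
    rw [dyadicCell_of_eq_zero h0]
    have : {ω | T ω = 0} = {ω | ((0 : ℝ≥0) : WithTop ℝ≥0) < T ω}ᶜ := by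
      ext ω
      change T ω = ⊥ ↔ ¬ (⊥ : WithTop ℝ≥0) < T ω
      rw [not_lt, le_bot_iff]
    rw [this]
    exact (measurableSet_leftSigma_of_zero hB).inter (measurableSet_leftSigma_lt 0).compl
  by_cases h1 : (k : ℕ) ≤ n * 2 ^ n
  · have : B ∩ dyadicCell T n k
        = (B ∩ {ω | (dyadicTime n (k - 1) : WithTop ℝ≥0) < T ω}) \
          {ω | (dyadicTime n k : WithTop ℝ≥0) < T ω} := by
      rw [dyadicCell_of_le h0 h1]
      ext ω
      simp only [dyadicEvent, Set.mem_inter_iff, Set.mem_ofPred_eq, Set.mem_sdiff, not_lt]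
      tauto
    rw [this]
    exact (measurableSet_leftSigma_inter hB).diff (measurableSet_leftSigma_lt _)
  · have hk : (k : ℕ) = n * 2 ^ n + 1 := by omega
    rw [hk, Nat.add_sub_cancel, dyadicTime_mul_two_pow] at hB
    rw [dyadicCell_of_eq_succ hk]
    exact measurableSet_leftSigma_inter hB

theorem cellSigma_le_leftSigma (n : ℕ) :
    cellSigma (dyadicCell T n) (dyadicSigma F n) ≤ leftSigma F T := by
  intro A hA
  rw [← iUnion_inter_cells (iUnion_dyadicCell (T := T) n) A]
  refine @MeasurableSet.iUnion _ _ (leftSigma F T) _ _ fun k => ?_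
  obtain ⟨B, hB, hAB⟩ := measurableSet_cellSigma.1 hA k
  rw [hAB]
  exact measurableSet_inter_dyadicCell hB

/-- A cell of level n + 1 lies in its parent and starts no earlier, so the set that serves on the
parent serves on the child. -/
theorem cellSigma_le_succ (n : ℕ) :
    cellSigma (dyadicCell T n) (dyadicSigma F n)
      ≤ cellSigma (dyadicCell T (n + 1)) (dyadicSigma F (n + 1)) := by
  intro A hA
  rw [measurableSet_cellSigma] at hA ⊢
  intro j
  have hlt : min (n * 2 ^ n + 1) (((j : ℕ) + 1) / 2) < n * 2 ^ n + 2 := by omega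
  obtain ⟨B, hB, hAB⟩ := hA ⟨_, hlt⟩
  refine ⟨B, F.mono ?_ _ hB, ?_⟩
  · rw [dyadicTime_succ]
    exact dyadicTime_mono_right _ (by simp only; omega)
  · have hsub : dyadicCell T (n + 1) j ⊆ dyadicCell T n ⟨_, hlt⟩ := fun ω hω => by
      simp only [dyadicCell, Set.mem_ofPred_eq] at hω ⊢
      rw [dyadicIndex_eq_succ, hω]
    rw [← Set.inter_eq_right.2 hsub, ← Set.inter_assoc, ← Set.inter_assoc, hAB]

/-- The filtration of the σ-algebras generated by the cells. -/
noncomputable def cellFiltration (F : Filtration ℝ≥0 m) (T : Ω → WithTop ℝ≥0) :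
    @Filtration Ω ℕ _ (leftSigma F T) :=
  @Filtration.mk Ω ℕ _ (leftSigma F T) (fun n => cellSigma (dyadicCell T n) (dyadicSigma F n))
    (monotone_nat_of_le_succ cellSigma_le_succ) cellSigma_le_leftSigma

/-- The event {c/2^n < T} is the union of the cells of index above c, and each of these starts at or
after c/2^n, where `A` is already known. -/
theorem measurableSet_cellSigma_inter {n c : ℕ} (hc : c ≤ n * 2 ^ n) {t : ℝ≥0}
    (ht : t ≤ dyadicTime n c) {A : Set Ω} (hA : MeasurableSet[F t] A) :
    MeasurableSet[cellSigma (dyadicCell T n) (dyadicSigma F n)]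
      (A ∩ {ω | (dyadicTime n c : WithTop ℝ≥0) < T ω}) := by
  rw [measurableSet_cellSigma]
  intro k
  have key : ∀ ω, (dyadicTime n c : WithTop ℝ≥0) < T ω ↔ c < dyadicIndex T n ω := fun ω => by
    rw [← not_le, ← dyadicIndex_le_iff hc, not_le]
  by_cases hk : (k : ℕ) ≤ c
  · refine ⟨∅, @MeasurableSet.empty _ (dyadicSigma F n k), ?_⟩
    ext ω
    simp only [Set.mem_inter_iff, Set.mem_ofPred_eq, key, dyadicCell, Set.mem_empty_iff_false,
      false_and, iff_false]
    rintro ⟨⟨-, h⟩, h'⟩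
    omega
  · refine ⟨A, F.mono (ht.trans (dyadicTime_mono_right n (by omega))) _ hA, ?_⟩
    ext ω
    simp only [Set.mem_inter_iff, Set.mem_ofPred_eq, key, dyadicCell]
    refine ⟨fun h => ⟨h.1.1, h.2⟩, fun h => ⟨⟨h.1, by omega⟩, h.2⟩⟩

theorem exists_dyadicTime_lt {t : ℝ≥0} {s : WithTop ℝ≥0} (h : (t : WithTop ℝ≥0) < s) :
    ∃ n : ℕ, t ≤ n ∧ (dyadicTime n ⌈t * 2 ^ n⌉₊ : WithTop ℝ≥0) < s := by
  obtain ⟨s', hts, hs⟩ : ∃ s' : ℝ≥0, t < s' ∧ (s' : WithTop ℝ≥0) ≤ s := by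
    rcases s with _ | s
    · exact ⟨t + 1, by simp, le_top⟩
    · exact ⟨s, WithTop.coe_lt_coe.1 h, le_rfl⟩
  have hd : 0 < s' - t := tsub_pos_of_lt hts
  obtain ⟨a, ha⟩ := exists_pow_lt_of_lt_one hd (show (1 / 2 : ℝ≥0) < 1 by
    rw [div_lt_one two_pos]; exact one_lt_two)
  refine ⟨max a ⌈t⌉₊, (Nat.le_ceil t).trans (by exact_mod_cast le_max_right _ _),
    lt_of_lt_of_le (WithTop.coe_lt_coe.2 ?_) hs⟩
  set n := max a ⌈t⌉₊
  have hn : (1 / 2 : ℝ≥0) ^ n < s' - t :=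
    lt_of_le_of_lt (pow_le_pow_of_le_one zero_le (by
      rw [div_le_one two_pos]; exact one_le_two) (le_max_left _ _)) ha
  have h1 : (⌈t * 2 ^ n⌉₊ : ℝ≥0) < t * 2 ^ n + 1 := Nat.ceil_lt_add_one zero_le
  unfold dyadicTime
  calc (⌈t * 2 ^ n⌉₊ : ℝ≥0) / 2 ^ n < (t * 2 ^ n + 1) / 2 ^ n := by gcongr
    _ = t + (1 / 2) ^ n := by rw [add_div, mul_div_cancel_right₀ _ (by positivity), div_pow, one_pow]
    _ < t + (s' - t) := by gcongr
    _ = s' := add_tsub_cancel_of_le hts.le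

theorem iSup_cellFiltration : ⨆ n, cellFiltration F T n = leftSigma F T := by
  refine le_antisymm (iSup_le cellSigma_le_leftSigma) (MeasurableSpace.generateFrom_le ?_)
  have hle : ∀ n, cellSigma (dyadicCell T n) (dyadicSigma F n) ≤ ⨆ n, cellFiltration F T n :=
    fun n => le_iSup (fun n => cellFiltration F T n) n
  rintro B (hB | ⟨t, A, hA, rfl⟩)
  · exact hle 0 _ (measurableSet_cellSigma.2 fun k => ⟨B, F.mono zero_le _ hB, rfl⟩)
  -- Approximate t from above by ⌈t 2^n⌉/2^n, within 2^(-n). The restriction t ≤ n keeps the index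
  -- at most n 2^n.
  · have e : A ∩ {ω | (t : WithTop ℝ≥0) < T ω} = ⋃ n : ℕ, ⋃ _ : t ≤ n,
        A ∩ {ω | (dyadicTime n ⌈t * 2 ^ n⌉₊ : WithTop ℝ≥0) < T ω} := by
      ext ω
      simp only [Set.mem_inter_iff, Set.mem_ofPred_eq, Set.mem_iUnion, exists_prop]
      constructor
      · rintro ⟨h1, h2⟩
        obtain ⟨n, hn, hn'⟩ := exists_dyadicTime_lt h2
        exact ⟨n, hn, h1, hn'⟩
      · rintro ⟨n, -, h1, h2⟩
        refine ⟨h1, lt_of_le_of_lt (WithTop.coe_le_coe.2 ?_) h2⟩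
        rw [dyadicTime, le_div_iff₀ (by positivity)]
        exact Nat.le_ceil _
    rw [e]
    refine @MeasurableSet.iUnion _ _ (_) _ _ fun n => @MeasurableSet.iUnion _ _ (_) _ _ fun hn =>
      hle n _ (measurableSet_cellSigma_inter ?_ ?_ hA)
    · rw [Nat.ceil_le]
      push_cast
      gcongr
    · rw [dyadicTime, le_div_iff₀ (by positivity)]
      exact Nat.le_ceil _

end Dyadic

/-! ### Identification of the bracket and the joint lower limit -/

variable {Ω : Type*} {m : MeasurableSpace Ω} {F : Filtration ℝ≥0 m} {T : Ω → WithTop ℝ≥0}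

theorem measurableSet_lt_of_isStoppingTime (hT : IsStoppingTime F T) (t : ℝ≥0) :
    MeasurableSet[F t] {ω | (t : WithTop ℝ≥0) < T ω} := by
  have h : {ω | (t : WithTop ℝ≥0) < T ω} = {ω | T ω ≤ t}ᶜ := by
    ext ω
    exact (not_le (a := T ω) (b := (t : WithTop ℝ≥0))).symm
  rw [h]
  exact (hT t).compl

theorem measurableSet_eq_zero_of_isStoppingTime (hT : IsStoppingTime F T) :
    MeasurableSet[F 0] {ω | T ω = 0} := by
  have h : {ω | T ω = 0} = {ω | T ω ≤ ((0 : ℝ≥0) : WithTop ℝ≥0)} := by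
    ext ω
    change T ω = ⊥ ↔ T ω ≤ ⊥
    rw [le_bot_iff]
  rw [h]
  exact hT 0

theorem measurableSet_dyadicEvent (hT : IsStoppingTime F T) (n k : ℕ) :
    MeasurableSet[F (dyadicTime n k)] (dyadicEvent T n k) :=
  (F.mono (dyadicTime_mono_right n (Nat.sub_le k 1)) _
    (measurableSet_lt_of_isStoppingTime hT _)).inter (hT _)

/-- The density, on the `k`-th cell of level `n`, appearing in `hellingerSum`. -/
noncomputable def cellDensity (F : Filtration ℝ≥0 m) (P : Measure Ω) (T : Ω → WithTop ℝ≥0)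
    (z : ℝ≥0 → Ω → ℝ) (n k : ℕ) : Ω → ℝ :=
  if k = 0 then {ω | T ω = 0}.indicator (z 0)
  else if k ≤ n * 2 ^ n then dyadicCondExp F P T z n k
  else {ω | ((n : ℝ≥0) : WithTop ℝ≥0) < T ω}.indicator (z n)

theorem isCellDensity_cellDensity {μ P : Measure Ω} [IsFiniteMeasure μ] [IsFiniteMeasure P]
    {z : ℝ≥0 → Ω → ℝ} (hz : IsDensityProcess F μ P z) (hμ : LocallyAC F μ P)
    (hT : IsStoppingTime F T) (n : ℕ) (k : Fin (n * 2 ^ n + 2)) :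
    IsCellDensity (dyadicSigma F n k) μ P (dyadicCell T n k) (cellDensity F P T z n k) := by
  unfold dyadicSigma cellDensity
  by_cases h0 : (k : ℕ) = 0
  · have e : dyadicTime n (k - 1) = 0 := by simp [h0, dyadicTime]
    rw [if_pos h0, e, dyadicCell_of_eq_zero h0]
    exact (hz.isCellDensity_univ hμ 0).indicator (F.le 0)
      (measurableSet_eq_zero_of_isStoppingTime hT)
  by_cases h1 : (k : ℕ) ≤ n * 2 ^ n
  · rw [if_neg h0, if_pos h1, dyadicCell_of_le h0 h1]
    exact ((hz.isCellDensity_univ hμ _).indicator (F.le _)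
      (measurableSet_dyadicEvent hT n k)).condExp
      (F.mono (dyadicTime_mono_right n (Nat.sub_le _ 1))) (F.le _)
  · have hk : (k : ℕ) = n * 2 ^ n + 1 := by omega
    rw [if_neg h0, if_neg h1, dyadicCell_of_eq_succ hk, hk, Nat.add_sub_cancel,
      dyadicTime_mul_two_pow]
    exact (hz.isCellDensity_univ hμ _).indicator (F.le _)
      (measurableSet_lt_of_isStoppingTime hT _)

/-- Since α > 0, 0^α = 0 and the integrand with indicators vanishes off `E`. -/
theorem setLIntegral_rpow_mul_rpow {P : Measure Ω} {E : Set Ω} (hE : MeasurableSet E)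
    (X Y : Ω → ℝ) {α : ℝ} (h0 : 0 < α) :
    ∫⁻ ω in E, ENNReal.ofReal (X ω ^ α * Y ω ^ (1 - α)) ∂P
      = ∫⁻ ω, ENNReal.ofReal (E.indicator X ω ^ α * E.indicator Y ω ^ (1 - α)) ∂P := by
  rw [← lintegral_indicator hE]
  refine lintegral_congr fun ω => ?_
  by_cases h : ω ∈ E <;> simp [h, Real.zero_rpow h0.ne']

theorem hellingerSum_eq_sum_cells {P : Measure Ω} (hT : IsStoppingTime F T) (z z' : ℝ≥0 → Ω → ℝ)
    (n : ℕ) {α : ℝ} (h0 : 0 < α) :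
    hellingerSum F P T z z' n α = ∑ k : Fin (n * 2 ^ n + 2), ∫⁻ ω, ENNReal.ofReal
      (cellDensity F P T z n k ω ^ α * cellDensity F P T z' n k ω ^ (1 - α)) ∂P := by
  rw [Fin.sum_univ_eq_sum_range (fun k => ∫⁻ ω, ENNReal.ofReal
      (cellDensity F P T z n k ω ^ α * cellDensity F P T z' n k ω ^ (1 - α)) ∂P),
    Finset.sum_range_succ, Finset.sum_range_succ', hellingerSum,
    setLIntegral_rpow_mul_rpow (F.le 0 _ (measurableSet_eq_zero_of_isStoppingTime hT)) _ _ h0,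
    setLIntegral_rpow_mul_rpow (F.le n _ (measurableSet_lt_of_isStoppingTime hT n)) _ _ h0,
    Finset.range_eq_Ico, Finset.sum_Ico_add' (fun k => ∫⁻ ω, ENNReal.ofReal
      (cellDensity F P T z n k ω ^ α * cellDensity F P T z' n k ω ^ (1 - α)) ∂P) 0 (n * 2 ^ n) 1]
  have e1 : ∀ y, cellDensity F P T y n 0 = {ω | T ω = 0}.indicator (y 0) := fun y => if_pos rfl
  have e2 : ∀ y, cellDensity F P T y n (n * 2 ^ n + 1)
      = {ω | ((n : ℝ≥0) : WithTop ℝ≥0) < T ω}.indicator (y n) := fun y => by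
    rw [cellDensity, if_neg (by omega), if_neg (by omega)]
  have e3 : ∑ k ∈ Finset.Icc 1 (n * 2 ^ n), ∫⁻ ω, ENNReal.ofReal
        (dyadicCondExp F P T z n k ω ^ α * dyadicCondExp F P T z' n k ω ^ (1 - α)) ∂P
      = ∑ k ∈ Finset.Ico (0 + 1) (n * 2 ^ n + 1), ∫⁻ ω, ENNReal.ofReal
        (cellDensity F P T z n k ω ^ α * cellDensity F P T z' n k ω ^ (1 - α)) ∂P := by
    refine Finset.sum_congr (by ext; simp) fun k hk => ?_
    rw [Finset.mem_Ico] at hk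
    have e : ∀ y, cellDensity F P T y n k = dyadicCondExp F P T y n k := fun y => by
      rw [cellDensity, if_neg (by omega), if_pos (by omega)]
    rw [e, e]
  rw [e1, e1, e2, e2, e3]
  ring

/-- `hellingerSum` is the Hellinger integral of the restrictions of `μ` and `ν` to the σ-algebra
generated by the cells of level `n`. -/
theorem hellingerSum_eq_hellingerIntegral {μ ν P : Measure Ω} [IsFiniteMeasure μ]
    [IsFiniteMeasure ν] [IsFiniteMeasure P] (hμ : LocallyAC F μ P) (hν : LocallyAC F ν P)
    {z z' : ℝ≥0 → Ω → ℝ} (hz : IsDensityProcess F μ P z) (hz' : IsDensityProcess F ν P z')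
    (hT : IsStoppingTime F T) (n : ℕ) {α : ℝ} (h0 : 0 < α) (h1 : α < 1) :
    hellingerSum F P T z z' n α = hellingerIntegral α
      ((leftMeasure μ hT).trim (cellSigma_le_leftSigma n))
      ((leftMeasure ν hT).trim (cellSigma_le_leftSigma n)) := by
  have hcell : ∀ k, MeasurableSet[m] (dyadicCell T n k) := fun k => leftSigma_le hT _ <| by
    simpa using measurableSet_inter_dyadicCell (F := F) (T := T) (k := k)
      (@MeasurableSet.univ _ (dyadicSigma F n k))
  rw [leftMeasure, leftMeasure, trim_trim, trim_trim, hellingerIntegral_cellSigma hcell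
    (fun k => F.le _) (pairwise_disjoint_dyadicCell n) (iUnion_dyadicCell n) _ h0 h1,
    hellingerSum_eq_sum_cells hT z z' n h0]
  -- On each cell P may serve as the dominating measure, by independence of that choice.
  exact Finset.sum_congr rfl fun k _ => ((isCellDensity_cellDensity hz hμ hT n k).hellingerIntegral_eq
    (F.le _) (isCellDensity_cellDensity hz' hν hT n k) h0 h1).symm

theorem acPart_leftMeasure_univ_eq_liminf {μ ν P : Measure Ω} [IsProbabilityMeasure μ]
    [IsProbabilityMeasure ν] [IsProbabilityMeasure P] (hμ : LocallyAC F μ P)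
    (hν : LocallyAC F ν P) {z z' : ℝ≥0 → Ω → ℝ} (hz : IsDensityProcess F μ P z)
    (hz' : IsDensityProcess F ν P z') (hT : IsStoppingTime F T) :
    acPart (leftMeasure μ hT) (leftMeasure ν hT) Set.univ
      = liminf (fun p : ℕ × ℝ => hellingerSum F P T z z' p.1 p.2) (atTop ×ˢ 𝓝[<] (1 : ℝ)) := by
  have : @IsFiniteMeasure Ω (leftSigma F T) (leftMeasure μ hT) :=
    isFiniteMeasure_trim (leftSigma_le hT)
  have : @IsFiniteMeasure Ω (leftSigma F T) (leftMeasure ν hT) :=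
    isFiniteMeasure_trim (leftSigma_le hT)
  have hlim := tendsto_hellingerIntegral_one (leftMeasure μ hT) (leftMeasure ν hT)
  have hI : ∀ᶠ α : ℝ in 𝓝[<] 1, α ∈ Set.Ioo (0 : ℝ) 1 := Ioo_mem_nhdsLT one_pos
  have hsum : ∀ n, ∀ α ∈ Set.Ioo (0 : ℝ) 1, hellingerSum F P T z z' n α = hellingerIntegral α
      ((leftMeasure μ hT).trim (cellSigma_le_leftSigma n))
      ((leftMeasure ν hT).trim (cellSigma_le_leftSigma n)) := fun n α hα =>
    hellingerSum_eq_hellingerIntegral hμ hν hz hz' hT n hα.1 hα.2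
  refine le_antisymm (le_of_forall_lt fun c hc => ?_) (le_of_forall_gt_imp_ge_of_dense fun c hc => ?_)
  -- Lower bound: by monotonicity the bracket dominates H_α on 𝓕_{T-} for every n, so only α → 1
  -- matters.
  · obtain ⟨d, hcd, hd⟩ := exists_between hc
    refine hcd.trans_le (le_liminf_of_le (by isBoundedDefault) ?_)
    filter_upwards [tendsto_snd.eventually (hI.and (hlim.eventually_const_lt hd))] with p hp
    rw [hsum _ _ hp.1]
    exact hp.2.le.trans (hellingerIntegral_le_trim _ hp.1.1 hp.1.2)
  -- Upper bound: were the bracket eventually above `c`, currying with α outermost would allow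
  -- fixing α with H_α < c and then letting n → ∞, a contradiction.
  · refine liminf_le_of_frequently_le' fun hev => ?_
    have hev' : ∀ᶠ p : ℝ × ℕ in 𝓝[<] (1 : ℝ) ×ˢ atTop, ¬ hellingerSum F P T z z' p.2 p.1 ≤ c :=
      eventually_swap_iff.1 hev
    obtain ⟨α, h, hα, hαc⟩ := (hev'.curry.and (hI.and (hlim.eventually_lt_const hc))).exists
    have hn := tendsto_hellingerIntegral_trim (cellFiltration F T) (μ := leftMeasure μ hT)
      (ν := leftMeasure ν hT) iSup_cellFiltration hα.1 hα.2
    obtain ⟨n, hn1, hn2⟩ := (h.and (hn.eventually_lt_const hαc)).exists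
    rw [hsum _ _ hα] at hn1
    exact hn1 hn2.le

end HellingerLeft

theorem mainTheorem3 {Ω : Type*} {m : MeasurableSpace Ω} (F : Filtration ℝ≥0 m)
    (μ ν P : Measure Ω) [IsProbabilityMeasure μ] [IsProbabilityMeasure ν] [IsProbabilityMeasure P]
    (hμ : HellingerLeft.LocallyAC F μ P) (hν : HellingerLeft.LocallyAC F ν P)
    (z z' : ℝ≥0 → Ω → ℝ)
    (hz : HellingerLeft.IsDensityProcess F μ P z) (hz' : HellingerLeft.IsDensityProcess F ν P z')
    (T : Ω → WithTop ℝ≥0) (hT : IsStoppingTime F T) :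
    HellingerLeft.acPart (HellingerLeft.leftMeasure μ hT) (HellingerLeft.leftMeasure ν hT) Set.univ
      = liminf (fun p : ℕ × ℝ => HellingerLeft.hellingerSum F P T z z' p.1 p.2)
          (atTop ×ˢ 𝓝[<] (1 : ℝ)) :=
  HellingerLeft.acPart_leftMeasure_univ_eq_liminf hμ hν hz hz' hT
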